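/- **Setting.** Let $n\ge 2$ and $T\ge 1$. A dynamic graph is a sequence $\mathcal G_0,\mathcal G_1,\dots$ of undirected simple graphs on a fixed set $V$ of $n$ anonymous nodes; in each $\mathcal G_r$ the ports of every node $v$ are labelled bijectively by $0,\dots,\deg_r(v)-1$, with no relation between the two labels of an edge or between the labels of different rounds. It is *$T$-Path Connected* if for every $r\ge 0$ and all $u,v\in V$ there is $i\in[r,r+T-1]$ such that $u,v$ lie in the same connected component of $\mathcal G_i$. There are $k=n-1$ agents with distinct IDs in $[1,k]$, placed arbitrarily on the nodes; an agent initially knows its own ID only (not $n$, $k$ or $T$). A node without agents is a *hole*, a node with at least two agents a *multinode*. In each synchronous round $r$, every agent sees the port-labelled subgraph of $\mathcal G_r$ induced by its node and the neighbours of its node, and the agents on these nodes (1-hop visibility); it broadcasts a message to all agents in its connected component of $\mathcal G_r$ (global communication); then it computes, and either stays or moves through one port. Its memory is what it keeps from one round to the next. **Algorithm (Perpetual Exploration).** An agent keeps only its ID. In each round it broadcasts its ID, the number of agents on its node, and its 1-hop view. In each connected component containing agents: * If the component contains a multinode and a hole, the agents determine, by a common deterministic rule from the broadcast information, a sliding path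 $w_1,\dots,w_p$: a path with distinct nodes such that $w_1$ is the multinode holding the agent whose ID is minimum among all agents of the component on multinodes, $w_2,\dots,w_{p-1}$ each hold an agent, and $w_p$ is a hole. For each $j<p$ the minimum-ID agent on $w_j$ moves to $w_{j+1}$; all others stay. * If it contains a multinode but no hole, all its agents stay. * If it contains no multinode, the minimum-ID agent among those having a hole as a neighbour (if any) moves through its minimum port leading to a hole; all others stay. **Theorem.** There are absolute constants $c,C,B>0$ such that, for every choice of the deterministic rule that selects sliding paths, for all $n\ge2$, $T\ge1$ and every assignment of distinct IDs from $[1,n-1]$ to the $n-1$ agents: 1. On every $T$-Path Connected dynamic graph with $n$ nodes and from every initial placement of the $n-1$ agents, the algorithm solves perpetual exploration: every node is visited infinitely often. Moreover, starting from any round (in particular from round $0$), every node is visited within the next $C\cdot n\cdot T$ rounds. 2. In all these executions every agent uses at most $B\log_2 n$ bits of memory. 3. There are a $T$-Path Connected dynamic graph with $n$ nodes and an initial placement of the $n-1$ agents for which the algorithm needs at least $c\cdot n\cdot T$ rounds until every node has been visited. Thus the algorithm solves perpetual exploration in $\Theta(n\cdot T)$ rounds with $O(\log n)$ bits of memory per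 agent. -/

import Mathlib

namespace DynExplore

noncomputable section

/-! ## Port-labelled dynamic graphs -/

/-- A port-labelled graph: `port v u` is the label, at the end `v`, of the edge between `v` and its
neighbour `u`; the labels at `v` are exactly `0, …, deg v - 1`. The labels at the two ends of an
edge are unrelated. -/
structure PortGraph (V : Type*) where
  graph : SimpleGraph V
  port : V → V → ℕ
  port_bijOn : ∀ v, Set.BijOn (port v) (graph.neighborSet v) (Set.Iio (graph.neighborSet v).ncard)

/-- A dynamic graph on the static node set `V`: one port-labelled graph per round. There is no
relation between the port labels of different rounds. -/
abbrev DynamicGraph (V : Type*) := ℕ → PortGraph V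

open Classical in
/-- The neighbour of `v` behind port `p`, if `v` has a port with this label. -/
def PortGraph.via {V : Type*} (G : PortGraph V) (v : V) (p : ℕ) : Option V :=
  if h : ∃ u, G.graph.Adj v u ∧ G.port v u = p then some h.choose else none

/-- `T`-path connectivity: among any `T` consecutive rounds, any two nodes lie in the same
connected component in at least one round. -/
def TPathConnected {V : Type*} (D : DynamicGraph V) (T : ℕ) : Prop :=
  ∀ r : ℕ, ∀ u v : V, ∃ i : ℕ, r ≤ i ∧ i < r + T ∧ (D i).graph.Reachable u v

/-! ## Agents with 1-hop visibility and global communication -/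

/-- What an agent sees from its node `w`: the port-labelled subgraph induced by the nodes at
distance at most one from `w`, and the agents on these nodes. Nodes are anonymous: a neighbour of
`w` is named by the port of `w` that leads to it. -/
structure View where
  /-- degree of `w` -/
  deg : ℕ
  /-- IDs of the agents on `w` -/
  here : Finset ℕ
  /-- IDs of the agents on the neighbour behind port `p` (`none` if there is no port `p`); the
  neighbour is a hole if the value is `some ∅` -/
  nbr : ℕ → Option (Finset ℕ)
  /-- label, at the other end, of the edge behind port `p` -/
  back : ℕ → Option ℕ
  /-- the two labels of the edge between the neighbours behind ports `p` and `q`, if there is one -/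
  edge : ℕ → ℕ → Option (ℕ × ℕ)

/-- A deterministic distributed algorithm. Every agent runs the same code. The persistent memory of
an agent is a bit string; initially it depends on nothing but the agent's own ID. In a round an
agent broadcasts a message computed from its memory and its view; then, from its memory, its view
and all messages sent in its connected component (its own included), it computes its new memory
and the port through which it leaves (`none`: it stays). -/
structure Algorithm where
  Msg : Type
  init : ℕ → List Bool
  send : List Bool → View → Msg
  act : List Bool → View → Multiset Msg → List Bool × Option ℕ

/-- Positions and memories of the agents. -/
structure Config (A V : Type*) where
  pos : A → V
  mem : A → List Bool

section Run

variable {A V : Type*} [Fintype A]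

open Classical in
/-- IDs of the agents on the node `u`. -/
def idsAt (ids : A → ℕ) (pos : A → V) (u : V) : Finset ℕ :=
  (Finset.univ.filter fun a => pos a = u).image ids

open Classical in
/-- The 1-hop view from the node `w`. -/
def viewAt (ids : A → ℕ) (G : PortGraph V) (pos : A → V) (w : V) : View where
  deg := (G.graph.neighborSet w).ncard
  here := idsAt ids pos w
  nbr := fun p => (G.via w p).map (idsAt ids pos)
  back := fun p => (G.via w p).map fun u => G.port u w
  edge := fun p q => (G.via w p).bind fun u => (G.via w q).bind fun x =>
    if G.graph.Adj u x then some (G.port u x, G.port x u) else none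

open Classical in
/-- The messages received by agent `a`: those of all agents in its connected component. -/
def received (𝒜 : Algorithm) (ids : A → ℕ) (G : PortGraph V) (c : Config A V) (a : A) :
    Multiset 𝒜.Msg :=
  (Finset.univ.filter fun b => G.graph.Reachable (c.pos a) (c.pos b)).val.map
    fun b => 𝒜.send (c.mem b) (viewAt ids G c.pos (c.pos b))

/-- Outcome of the communicate and compute phases for agent `a`. -/
def decision (𝒜 : Algorithm) (ids : A → ℕ) (G : PortGraph V) (c : Config A V) (a : A) :
    List Bool × Option ℕ :=
  𝒜.act (c.mem a) (viewAt ids G c.pos (c.pos a)) (received 𝒜 ids G c a)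

/-- One synchronous round. -/
def round (𝒜 : Algorithm) (ids : A → ℕ) (G : PortGraph V) (c : Config A V) : Config A V where
  pos := fun a => (((decision 𝒜 ids G c a).2).bind (G.via (c.pos a))).getD (c.pos a)
  mem := fun a => (decision 𝒜 ids G c a).1

/-- The execution: `run 𝒜 ids D pos₀ t` is the configuration at the beginning of round `t`
(after `t` rounds have been completed). -/
def run (𝒜 : Algorithm) (ids : A → ℕ) (D : DynamicGraph V) (pos₀ : A → V) : ℕ → Config A V
  | 0 => ⟨pos₀, fun a => 𝒜.init (ids a)⟩
  | t + 1 => round 𝒜 ids (D t) (run 𝒜 ids D pos₀ t)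

end Run

/-- Every node is visited by an agent at some time in `[s, e]`. -/
def ExploredBetween {A V : Type*} (x : ℕ → Config A V) (s e : ℕ) : Prop :=
  ∀ v : V, ∃ t : ℕ, s ≤ t ∧ t ≤ e ∧ ∃ a : A, (x t).pos a = v

/-- Every node is visited infinitely often. -/
def PerpetuallyExplored {A V : Type*} (x : ℕ → Config A V) : Prop :=
  ∀ v : V, ∀ s : ℕ, ∃ t : ℕ, s ≤ t ∧ ∃ a : A, (x t).pos a = v

/-! ## The perpetual exploration algorithm -/

/-- The message broadcast by an agent: its ID, the number of agents on its node, its view. -/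
structure Report where
  id : ℕ
  count : ℕ
  view : View

/-- According to the reports `K`, there is a multinode in the component. -/
def MultinodeKnown (K : Multiset Report) : Prop := ∃ m ∈ K, 1 < m.count

/-- According to the view, the neighbour behind port `p` is a hole. -/
def View.HoleAt (w : View) (p : ℕ) : Prop := w.nbr p = some ∅

/-- According to the reports `K`, there is a hole in the component. -/
def HoleKnown (K : Multiset Report) : Prop := ∃ m ∈ K, ∃ p, m.view.HoleAt p

/-- According to the reports `K`, the agent `bp.1` has a port `bp.2`, and `S` is the set of IDs of
the agents on the node behind it. -/
def LeadsTo (K : Multiset Report) (bp : ℕ × ℕ) (S : Finset ℕ) : Prop :=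
  ∃ m ∈ K, m.id = bp.1 ∧ m.view.nbr bp.2 = some S

/-- `P = [(b₁, p₁), …, (bₗ, pₗ)]` is a sliding path for the reports `K`. It stands for the path
`w₁, …, wₗ, wₗ₊₁` in which `bⱼ` is on `wⱼ` and port `pⱼ` of `wⱼ` leads to `wⱼ₊₁`. Here `b₁` is the
minimum ID among the agents on multinodes, `bⱼ` is the minimum ID on `wⱼ`, the nodes are distinct,
and `wₗ₊₁` is a hole. -/
structure IsSlidingPath (K : Multiset Report) (P : List (ℕ × ℕ)) : Prop where
  start : ∃ bp ∈ P.head?, IsLeast {i | ∃ m ∈ K, m.id = i ∧ 1 < m.count} bp.1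
  chain : P.IsChain fun bp bp' => ∃ S, LeadsTo K bp S ∧ IsLeast (S : Set ℕ) bp'.1
  hole : ∃ bp ∈ P.getLast?, LeadsTo K bp ∅
  nodup : (P.map Prod.fst).Nodup

/-- A deterministic rule by which all agents of a component, having the same reports, agree on one
sliding path: it returns a sliding path whenever there is one. -/
def IsSlidingRule (σ : Multiset Report → List (ℕ × ℕ)) : Prop :=
  ∀ K, (∃ P, IsSlidingPath K P) → IsSlidingPath K (σ K)

/-- A sliding rule: among all sliding paths take the one with the least code. -/
def slidingPath (K : Multiset Report) : List (ℕ × ℕ) :=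
  open Classical in
  if h : ∃ c : ℕ, ∃ P, Encodable.encode P = c ∧ IsSlidingPath K P then (Nat.find_spec h).choose
  else []

theorem slidingPath_isSlidingRule : IsSlidingRule slidingPath := by
  classical
  rintro K ⟨P, hP⟩
  have h : ∃ c : ℕ, ∃ P, Encodable.encode P = c ∧ IsSlidingPath K P := ⟨_, P, rfl, hP⟩
  unfold slidingPath
  rw [dif_pos h]
  exact (Nat.find_spec h).choose_spec.2

/-- The number with the given binary digits, least significant first. -/
def ofBits (l : List Bool) : ℕ := Nat.ofDigits 2 (l.map Bool.toNat)

theorem ofBits_bits (i : ℕ) : ofBits i.bits = i := by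
  have h : (Bool.toNat) = fun b => cond b 1 0 := by
    funext b; cases b <;> rfl
  rw [ofBits, h, ← Nat.digits_two_eq_bits, Nat.ofDigits_digits]

open Classical in
/-- The perpetual exploration algorithm, with sliding rule `σ`. An agent remembers nothing but its
ID, and broadcasts its ID, the number of agents on its node, and its view.
* If there is a multinode in the component (the agent's own node, or one it is told of): if there
  is also a hole, the agents on the sliding path chosen by `σ` move along it; otherwise all stay.
* If there is no multinode in the component: the agent with the minimum ID among those with a hole
  in their neighbourhood moves through its minimum port that leads to a hole; all others stay. -/
def perpetualExploration (σ : Multiset Report → List (ℕ × ℕ)) : Algorithm where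
  Msg := Report
  init := Nat.bits
  send := fun mem w => ⟨ofBits mem, w.here.card, w⟩
  act := fun mem w K =>
    (mem,
      if MultinodeKnown K then
        if HoleKnown K then (σ K).lookup (ofBits mem) else none
      else if IsLeast {i | ∃ m ∈ K, m.id = i ∧ ∃ p, m.view.HoleAt p} (ofBits mem) then
        some (sInf {p | w.HoleAt p})
      else none)

end

end DynExplore

open DynExplore

open DynExplore

namespace DynExplore

variable {A V : Type*}

/-! Upper bound: the potential is the number of occupied nodes. Call an agent a leader if its ID is
minimal on its node, so that occupied nodes correspond to leaders. One round is injective on leaders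
(`nextPos_injOn`), hence the potential never drops. A slide also leaves a non-leader on the starting
multinode, where no leader arrives, so the potential grows (`card_occupied_lt_nextPos`).

Suppose that a node `v` stays unvisited for `T` rounds and the potential stays constant. With a
multinode present, its agents are frozen until path connectivity puts them in the component of `v`,
which forces a slide. Without one, `v` is the only hole and is entered as soon as it has a
neighbour. Both are contradictory (`card_occupied_run_lt`). Since the potential lies between 1 and
`n - 1`, at most `n - 1` windows are needed (`exists_visit`).

Lower bound: at most one agent per component enters a hole in a round (`nextPos_hole_unique`). If
the graph is complete once every `T` rounds and edgeless otherwise, and all agents start together,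
at most `1 + t / T` nodes have been visited by time `t` (`exists_visited_finset`). -/

theorem PortGraph.via_eq_some_iff (G : PortGraph V) {v u : V} {p : ℕ} :
    G.via v p = some u ↔ G.graph.Adj v u ∧ G.port v u = p := by
  unfold PortGraph.via
  split_ifs with h
  · rw [Option.some_inj]
    refine ⟨fun e => e ▸ h.choose_spec, fun hu => ?_⟩
    exact (G.port_bijOn v).injOn h.choose_spec.1 hu.1 (h.choose_spec.2.trans hu.2.symm)
  · simp only [false_iff]
    exact fun hu => h ⟨u, hu⟩

theorem lookup_eq_some_iff_mem {P : List (ℕ × ℕ)} (hP : (P.map Prod.fst).Nodup) {b p : ℕ} :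
    P.lookup b = some p ↔ (b, p) ∈ P := by
  induction P with
  | nil => simp
  | cons x P ih =>
    obtain ⟨c, q⟩ := x
    rw [List.map_cons, List.nodup_cons] at hP
    rw [List.lookup_cons]
    by_cases hbc : b = c
    · subst hbc
      simp only [beq_self_eq_true, Option.some_inj, List.mem_cons, Prod.mk.injEq, true_and]
      refine ⟨fun h => Or.inl h.symm, ?_⟩
      rintro (h | h)
      · exact h.symm
      · exact absurd (List.mem_map_of_mem (f := Prod.fst) h) hP.1
    · simp [beq_eq_false_iff_ne.2 hbc, hbc, ih hP.2]

/-- Agent `a` has the minimum ID on its node. -/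
def IsLeader (ids : A → ℕ) (pos : A → V) (a : A) : Prop := ∀ b, pos b = pos a → ids a ≤ ids b

theorem IsLeader.eq {ids : A → ℕ} {pos : A → V} (hids : Function.Injective ids)
    {a b : A} (ha : IsLeader ids pos a) (hb : IsLeader ids pos b) (h : pos a = pos b) : a = b :=
  hids (le_antisymm (ha b h.symm) (hb a h))

/-- The agents `b 0, …, b l`, minimal on their nodes, move along a sliding path in the component of
the node `w`; all other agents of this component stay. -/
structure Slides (ids : A → ℕ) (G : PortGraph V) (pos next : A → V) (w : V) (l : ℕ) (b : ℕ → A) :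
    Prop where
  reach : ∀ j ≤ l, G.graph.Reachable w (pos (b j))
  leader : ∀ j ≤ l, IsLeader ids pos (b j)
  inj : ∀ i ≤ l, ∀ j ≤ l, b i = b j → i = j
  multi : ∃ x, x ≠ b 0 ∧ pos x = pos (b 0)
  step : ∀ j < l, next (b j) = pos (b (j + 1))
  last : ∀ a, pos a ≠ next (b l)
  stay : ∀ a, G.graph.Reachable w (pos a) → (∀ j ≤ l, a ≠ b j) → next a = pos a

/-! ### Combinatorics of a single slide -/

namespace Slides

variable {ids : A → ℕ} {G : PortGraph V} {pos : A → V} {next : A → V} {w : V} {l : ℕ} {b : ℕ → A}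

theorem eq_or_eq (hs : Slides ids G pos next w l b) {a : A} (ha : G.graph.Reachable w (pos a)) :
    (∃ j ≤ l, a = b j) ∨ (next a = pos a ∧ ∀ j ≤ l, a ≠ b j) := by
  by_cases h : ∃ j ≤ l, a = b j
  · exact Or.inl h
  · push Not at h
    exact Or.inr ⟨hs.stay a ha h, h⟩

theorem eq_last (hs : Slides ids G pos next w l b) {a : A} (ha : G.graph.Reachable w (pos a))
    (hh : ∀ c, pos c ≠ next a) : a = b l := by
  rcases hs.eq_or_eq ha with ⟨j, hj, rfl⟩ | ⟨h, -⟩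
  · rcases hj.lt_or_eq with hj | rfl
    · exact absurd (hs.step j hj).symm (hh _)
    · rfl
  · exact absurd h.symm (hh a)

/-- The last slider enters a hole, so only an earlier one can land on an occupied node, whose unique
leader is the next slider. This decides every possible collision below. -/
theorem eq_step_of_next_eq (hids : Function.Injective ids) (hs : Slides ids G pos next w l b)
    {j : ℕ} (hj : j ≤ l) {a : A} (ha : IsLeader ids pos a) (h : next (b j) = pos a) :
    j < l ∧ a = b (j + 1) := by
  rcases hj.lt_or_eq with hj | rfl
  · exact ⟨hj, ha.eq hids (hs.leader _ hj) (h.symm.trans (hs.step j hj))⟩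
  · exact absurd h.symm (hs.last a)

theorem injOn (hids : Function.Injective ids) (hs : Slides ids G pos next w l b) {a c : A}
    (ha : G.graph.Reachable w (pos a)) (hc : G.graph.Reachable w (pos c))
    (hla : IsLeader ids pos a) (hlc : IsLeader ids pos c) (h : next a = next c) : a = c := by
  rcases hs.eq_or_eq ha with ⟨i, hi, rfl⟩ | ⟨ha', ha⟩
  · rcases hs.eq_or_eq hc with ⟨j, hj, rfl⟩ | ⟨hc', hc⟩
    · rcases hj.lt_or_eq with hj | rfl
      · obtain ⟨hi', e⟩ := hs.eq_step_of_next_eq hids hi (hs.leader (j + 1) hj)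
          (h.trans (hs.step j hj))
        have := hs.inj _ hj _ hi' e
        rw [show j = i by omega]
      -- Here `c` is the last slider, so the common target is a hole, which only the last slider
      -- enters.
      · exact hs.eq_last ha (by rw [h]; exact hs.last)
    · obtain ⟨hi', e⟩ := hs.eq_step_of_next_eq hids hi hlc (h.trans hc')
      exact absurd e (hc _ hi')
  · rcases hs.eq_or_eq hc with ⟨j, hj, rfl⟩ | ⟨hc', -⟩
    · obtain ⟨hj', e⟩ := hs.eq_step_of_next_eq hids hj hla (h.symm.trans ha')
      exact absurd e (ha _ hj')
    · exact hla.eq hids hlc (ha'.symm.trans (h.trans hc'))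

/-- An agent left behind on the multinode keeps it occupied, and no minimal agent arrives there. -/
theorem exists_extra (hids : Function.Injective ids) (hs : Slides ids G pos next w l b) :
    ∃ x, G.graph.Reachable w (next x) ∧ ¬IsLeader ids pos x ∧
      ∀ a, G.graph.Reachable w (pos a) → IsLeader ids pos a → next a ≠ next x := by
  obtain ⟨x, hx, hxpos⟩ := hs.multi
  have hl : ¬IsLeader ids pos x := fun h => hx (h.eq hids (hs.leader 0 (Nat.zero_le _)) hxpos)
  have hw : G.graph.Reachable w (pos x) := hxpos ▸ hs.reach 0 (Nat.zero_le _)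
  have hnx : next x = pos (b 0) := by
    rw [hs.stay x hw fun j hj h => hl (h ▸ hs.leader j hj), hxpos]
  refine ⟨x, by rw [hnx, ← hxpos]; exact hw, hl, fun a ha hla h => ?_⟩
  rw [hnx] at h
  rcases hs.eq_or_eq ha with ⟨j, hj, rfl⟩ | ⟨ha', ha⟩
  · obtain ⟨hj', e⟩ := hs.eq_step_of_next_eq hids hj (hs.leader 0 (Nat.zero_le _)) h
    have := hs.inj 0 (Nat.zero_le _) (j + 1) hj' e
    omega
  · exact ha 0 (Nat.zero_le _)
      (hla.eq hids (hs.leader 0 (Nat.zero_le _)) (ha'.symm.trans h))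

end Slides

/-! ### The algorithm as a memoryless map on positions -/

section Agents

variable [Fintype A]

/-- What agent `b` broadcasts when the agents stand at `pos`. -/
noncomputable def report (ids : A → ℕ) (G : PortGraph V) (pos : A → V) (b : A) : Report :=
  ⟨ids b, (idsAt ids pos (pos b)).card, viewAt ids G pos (pos b)⟩

open Classical in
/-- The reports received by agent `a`. -/
noncomputable def reports (ids : A → ℕ) (G : PortGraph V) (pos : A → V) (a : A) :
    Multiset Report :=
  (Finset.univ.filter fun b => G.graph.Reachable (pos a) (pos b)).val.map (report ids G pos)

open Classical in
/-- The port through which agent `a` leaves. -/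
noncomputable def exitPort (σ : Multiset Report → List (ℕ × ℕ)) (ids : A → ℕ) (G : PortGraph V)
    (pos : A → V) (a : A) : Option ℕ :=
  if MultinodeKnown (reports ids G pos a) then
    if HoleKnown (reports ids G pos a) then (σ (reports ids G pos a)).lookup (ids a) else none
  else if IsLeast {i | ∃ m ∈ reports ids G pos a, m.id = i ∧ ∃ p, m.view.HoleAt p} (ids a) then
    some (sInf {p | (viewAt ids G pos (pos a)).HoleAt p})
  else none

/-- The position of agent `a` after one round. -/
noncomputable def nextPos (σ : Multiset Report → List (ℕ × ℕ)) (ids : A → ℕ) (G : PortGraph V)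
    (pos : A → V) (a : A) : V :=
  ((exitPort σ ids G pos a).bind (G.via (pos a))).getD (pos a)

variable {σ : Multiset Report → List (ℕ × ℕ)} {ids : A → ℕ} {G : PortGraph V} {pos : A → V}

theorem received_eq_reports {c : Config A V} (hc : ∀ a, c.mem a = (ids a).bits) (a : A) :
    received (perpetualExploration σ) ids G c a = reports ids G c.pos a := by
  unfold received reports
  refine Multiset.map_congr rfl fun b _ => ?_
  simp only [perpetualExploration, report, hc, ofBits_bits]
  rfl

/-- The memory always decodes to the ID, so from here on executions can be studied through positions
alone. -/
theorem round_pos {c : Config A V} (hc : ∀ a, c.mem a = (ids a).bits) :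
    (round (perpetualExploration σ) ids G c).pos = nextPos σ ids G c.pos := by
  funext a
  simp only [round, decision, received_eq_reports hc]
  simp only [perpetualExploration, hc]
  have e := ofBits_bits (ids a)
  generalize ofBits (ids a).bits = i at e ⊢
  subst e
  rfl

theorem run_mem (D : DynamicGraph V) (pos₀ : A → V) (t : ℕ) (a : A) :
    (run (perpetualExploration σ) ids D pos₀ t).mem a = (ids a).bits := by
  induction t generalizing a with
  | zero => rfl
  | succ t ih => exact ih a

theorem run_pos_succ (D : DynamicGraph V) (pos₀ : A → V) (t : ℕ) :
    (run (perpetualExploration σ) ids D pos₀ (t + 1)).pos =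
      nextPos σ ids (D t) (run (perpetualExploration σ) ids D pos₀ t).pos :=
  round_pos (run_mem D pos₀ t)

theorem mem_idsAt {v : V} {i : ℕ} : i ∈ idsAt ids pos v ↔ ∃ a, pos a = v ∧ ids a = i := by
  simp [idsAt]

theorem idsAt_eq_empty_iff {v : V} : idsAt ids pos v = ∅ ↔ ∀ a, pos a ≠ v := by
  simp [idsAt, Finset.filter_eq_empty_iff]

theorem one_lt_card_idsAt (hids : Function.Injective ids) {v : V} :
    1 < (idsAt ids pos v).card ↔ ∃ a b, pos a = v ∧ pos b = v ∧ a ≠ b := by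
  rw [Finset.one_lt_card]
  constructor
  · rintro ⟨i, hi, j, hj, hij⟩
    obtain ⟨a, ha, rfl⟩ := mem_idsAt.1 hi
    obtain ⟨b, hb, rfl⟩ := mem_idsAt.1 hj
    exact ⟨a, b, ha, hb, fun h => hij (h ▸ rfl)⟩
  · rintro ⟨a, b, ha, hb, hab⟩
    exact ⟨ids a, mem_idsAt.2 ⟨a, ha, rfl⟩, ids b, mem_idsAt.2 ⟨b, hb, rfl⟩,
      fun h => hab (hids h)⟩

theorem mem_reports {a : A} {m : Report} :
    m ∈ reports ids G pos a ↔ ∃ b, G.graph.Reachable (pos a) (pos b) ∧ report ids G pos b = m := by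
  simp [reports]

/-- Global communication gives the whole component the same information; this is why its agents
agree on one sliding path. -/
theorem reports_congr {a b : A} (h : G.graph.Reachable (pos a) (pos b)) :
    reports ids G pos a = reports ids G pos b := by
  unfold reports
  congr 2
  ext c
  simp only [Finset.mem_filter, Finset.mem_univ, true_and]
  exact ⟨fun h' => h.symm.trans h', fun h' => h.trans h'⟩

theorem viewAt_nbr_eq_some {w : V} {p : ℕ} {S : Finset ℕ} :
    (viewAt ids G pos w).nbr p = some S ↔ ∃ u, G.via w p = some u ∧ idsAt ids pos u = S := by
  simp [viewAt, Option.map_eq_some_iff]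

theorem viewAt_holeAt {w : V} {p : ℕ} :
    (viewAt ids G pos w).HoleAt p ↔ ∃ u, G.via w p = some u ∧ ∀ a, pos a ≠ u := by
  simp only [View.HoleAt, viewAt_nbr_eq_some, idsAt_eq_empty_iff]

theorem multinodeKnown_reports (hids : Function.Injective ids) {a : A} :
    MultinodeKnown (reports ids G pos a) ↔
      ∃ b c, G.graph.Reachable (pos a) (pos b) ∧ pos b = pos c ∧ b ≠ c := by
  unfold MultinodeKnown
  constructor
  · rintro ⟨m, hm, h⟩
    obtain ⟨b, hb, rfl⟩ := mem_reports.1 hm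
    obtain ⟨c, d, hc, hd, hcd⟩ := (one_lt_card_idsAt hids).1 h
    exact ⟨c, d, hc ▸ hb, hc.trans hd.symm, hcd⟩
  · rintro ⟨b, c, hb, hbc, hne⟩
    exact ⟨_, mem_reports.2 ⟨b, hb, rfl⟩, (one_lt_card_idsAt hids).2 ⟨b, c, rfl, hbc.symm, hne⟩⟩

theorem holeKnown_reports {a : A} :
    HoleKnown (reports ids G pos a) ↔
      ∃ b u, G.graph.Reachable (pos a) (pos b) ∧ G.graph.Adj (pos b) u ∧ ∀ c, pos c ≠ u := by
  unfold HoleKnown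
  constructor
  · rintro ⟨m, hm, p, h⟩
    obtain ⟨b, hb, rfl⟩ := mem_reports.1 hm
    obtain ⟨u, hu, hh⟩ := viewAt_holeAt.1 h
    exact ⟨b, u, hb, (G.via_eq_some_iff.1 hu).1, hh⟩
  · rintro ⟨b, u, hb, hu, hh⟩
    exact ⟨_, mem_reports.2 ⟨b, hb, rfl⟩, _,
      viewAt_holeAt.2 ⟨u, G.via_eq_some_iff.2 ⟨hu, rfl⟩, hh⟩⟩

theorem leadsTo_reports (hids : Function.Injective ids) {a b : A}
    (hb : G.graph.Reachable (pos a) (pos b)) {p : ℕ} {S : Finset ℕ} :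
    LeadsTo (reports ids G pos a) (ids b, p) S ↔
      ∃ u, G.via (pos b) p = some u ∧ idsAt ids pos u = S := by
  unfold LeadsTo
  constructor
  · rintro ⟨m, hm, hi, h⟩
    obtain ⟨c, hc, rfl⟩ := mem_reports.1 hm
    obtain rfl : c = b := hids hi
    exact viewAt_nbr_eq_some.1 h
  · exact fun h => ⟨_, mem_reports.2 ⟨b, hb, rfl⟩, rfl, viewAt_nbr_eq_some.2 h⟩

theorem isLeast_idsAt {a : A} :
    IsLeast (idsAt ids pos (pos a) : Set ℕ) (ids a) ↔ IsLeader ids pos a := by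
  constructor
  · exact fun h b hb => h.2 (Finset.mem_coe.2 (mem_idsAt.2 ⟨b, hb, rfl⟩))
  · refine fun h => ⟨Finset.mem_coe.2 (mem_idsAt.2 ⟨a, rfl, rfl⟩), fun i hi => ?_⟩
    obtain ⟨b, hb, rfl⟩ := mem_idsAt.1 (Finset.mem_coe.1 hi)
    exact h b hb

theorem exists_isLeader (ids : A → ℕ) (pos : A → V) (a : A) :
    ∃ b, pos b = pos a ∧ IsLeader ids pos b := by
  classical
  obtain ⟨b, hb, hmin⟩ := (Finset.univ.filter fun b => pos b = pos a).exists_min_image ids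
    ⟨a, by simp⟩
  simp only [Finset.mem_filter, Finset.mem_univ, true_and] at hb hmin
  exact ⟨b, hb, fun c hc => hmin c (hc.trans hb)⟩

theorem nextPos_of_exitPort_eq_none {a : A} (h : exitPort σ ids G pos a = none) :
    nextPos σ ids G pos a = pos a := by
  simp [nextPos, h]

theorem nextPos_of_via {a : A} {p : ℕ} {u : V} (h : exitPort σ ids G pos a = some p)
    (hu : G.via (pos a) p = some u) : nextPos σ ids G pos a = u := by
  simp [nextPos, h, hu]

theorem reachable_nextPos (a : A) : G.graph.Reachable (pos a) (nextPos σ ids G pos a) := by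
  unfold nextPos
  cases h : (exitPort σ ids G pos a).bind (G.via (pos a)) with
  | none => exact .rfl
  | some u =>
    obtain ⟨p, -, hp⟩ := Option.bind_eq_some_iff.1 h
    exact (G.via_eq_some_iff.1 hp).1.reachable

/-! ### Existence and execution of sliding paths -/

/-- Along a simple path from an occupied node to a hole there is a list of agents and ports with
the properties of a sliding path. -/
theorem exists_chain_of_path (hids : Function.Injective ids) (a : A) {v h : V}
    (q : G.graph.Walk v h) (hq : q.IsPath) (hh : ∀ c, pos c ≠ h) (b : A) (hb : pos b = v)
    (hlb : IsLeader ids pos b) (hab : G.graph.Reachable (pos a) v) :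
    ∃ P : List (ℕ × ℕ), (∃ p, (ids b, p) ∈ P.head?) ∧
      (P.IsChain fun bp bp' => ∃ S, LeadsTo (reports ids G pos a) bp S ∧
        IsLeast (S : Set ℕ) bp'.1) ∧
      (∃ bp ∈ P.getLast?, LeadsTo (reports ids G pos a) bp ∅) ∧
      (P.map Prod.fst).Nodup ∧
      ∀ i ∈ P.map Prod.fst, ∃ c, ids c = i ∧ pos c ∈ q.support := by
  induction q generalizing b with
  | nil => exact absurd hb (hh b)
  | @cons v u h hvu q ih =>
    rw [SimpleGraph.Walk.cons_isPath_iff] at hq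
    subst hb
    have hvia : G.via (pos b) (G.port (pos b) u) = some u := G.via_eq_some_iff.2 ⟨hvu, rfl⟩
    by_cases hu : ∃ c, pos c = u
    · obtain ⟨c₀, rfl⟩ := hu
      obtain ⟨c, hc, hlc⟩ := exists_isLeader ids pos c₀
      obtain ⟨P, ⟨p, hp⟩, hchain, hlast, hnd, hsup⟩ :=
        ih hq.1 hh c hc hlc (hab.trans hvu.reachable)
      cases P with
      | nil => simp at hp
      | cons y P =>
        simp only [List.head?_cons, Option.mem_def, Option.some_inj] at hp
        subst hp
        refine ⟨(ids b, G.port (pos b) (pos c₀)) :: (ids c, p) :: P, ⟨_, rfl⟩, ?_, ?_, ?_, ?_⟩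
        · rw [List.isChain_cons_cons]
          refine ⟨⟨idsAt ids pos (pos c₀), (leadsTo_reports hids hab).2 ⟨_, hvia, rfl⟩, ?_⟩,
            hchain⟩
          rw [← hc]
          exact isLeast_idsAt.2 hlc
        · simpa [List.getLast?_cons_cons] using hlast
        · rw [List.map_cons, List.nodup_cons]
          -- A repeated ID would put the node of `b` on the rest of the path; the support clause is
          -- carried through the induction for this purpose.
          refine ⟨fun hmem => ?_, hnd⟩
          obtain ⟨d, hd, hds⟩ := hsup _ hmem
          exact hq.2 (hids hd ▸ hds)
        · intro i hi
          rw [List.map_cons, List.mem_cons] at hi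
          rcases hi with rfl | hi
          · exact ⟨b, rfl, by simp⟩
          · obtain ⟨d, hd, hds⟩ := hsup i hi
            exact ⟨d, hd, by simp [hds]⟩
    -- The list ends at the first hole met, which need not be `h`.
    · push Not at hu
      refine ⟨[(ids b, G.port (pos b) u)], ⟨_, rfl⟩, List.isChain_singleton _,
        ⟨_, rfl, (leadsTo_reports hids hab).2 ⟨u, hvia, idsAt_eq_empty_iff.2 hu⟩⟩, by simp, ?_⟩
      intro i hi
      simp only [List.map_cons, List.map_nil, List.mem_singleton] at hi
      exact ⟨b, hi.symm, by simp⟩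

/-- The least ID on multinodes is also least on its own node, since everyone there is on a
multinode. A simple path from that node to the hole then yields the list. -/
theorem exists_isSlidingPath (hids : Function.Injective ids) {a : A} {h : V}
    (hm : MultinodeKnown (reports ids G pos a)) (hreach : G.graph.Reachable (pos a) h)
    (hh : ∀ c, pos c ≠ h) : ∃ P, IsSlidingPath (reports ids G pos a) P := by
  set I : Set ℕ := {i | ∃ m ∈ reports ids G pos a, m.id = i ∧ 1 < m.count} with hI
  have hne : I.Nonempty := by
    obtain ⟨m, hm, h⟩ := hm
    exact ⟨m.id, m, hm, rfl, h⟩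
  have hleast : IsLeast I (sInf I) := ⟨Nat.sInf_mem hne, fun i hi => Nat.sInf_le hi⟩
  obtain ⟨m, hmK, hid, hcount⟩ := hleast.1
  obtain ⟨b, hb, rfl⟩ := mem_reports.1 hmK
  have hlb : IsLeader ids pos b := by
    intro c hc
    have hcI : ids c ∈ I := by
      refine ⟨_, mem_reports.2 ⟨c, hc ▸ hb, rfl⟩, rfl, ?_⟩
      change 1 < (idsAt ids pos (pos c)).card
      rw [hc]
      exact hcount
    have := hleast.2 hcI
    rwa [← hid] at this
  obtain ⟨q, hq⟩ := (hb.symm.trans hreach).exists_isPath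
  obtain ⟨P, ⟨p, hp⟩, hchain, hlast, hnd, -⟩ :=
    exists_chain_of_path hids a q hq hh b rfl hlb hb
  refine ⟨P, ⟨⟨_, hp, ?_⟩, hchain, hlast, hnd⟩⟩
  have : ids b = sInf I := hid
  simpa only [this] using hleast

/-- In a component with a multinode and a hole a slide takes place. -/
theorem exists_slides (hσ : IsSlidingRule σ) (hids : Function.Injective ids) {a : A}
    (hm : MultinodeKnown (reports ids G pos a)) (hK : HoleKnown (reports ids G pos a)) :
    ∃ l b, Slides ids G pos (nextPos σ ids G pos) (pos a) l b := by
  obtain ⟨b₀, u₀, hb₀, hu₀, hh₀⟩ := holeKnown_reports.1 hK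
  have hP := hσ _ (exists_isSlidingPath hids hm (hb₀.trans hu₀.reachable) hh₀)
  set K := reports ids G pos a with hKdef
  set P := σ K with hPdef
  obtain ⟨⟨bp, hbp, hleast⟩, hchain, ⟨bp', hbp', hlast⟩, hnd⟩ := hP
  have hpos : 0 < P.length := by
    rcases P with _ | _
    · simp at hbp
    · simp
  obtain ⟨l, hl⟩ : ∃ l, P.length = l + 1 := ⟨P.length - 1, by omega⟩
  have hhead : P[0] = bp := by
    rw [Option.mem_def, List.head?_eq_getElem?, List.getElem?_eq_getElem hpos] at hbp
    exact Option.some_inj.1 hbp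
  have hend : P[l] = bp' := by
    rw [Option.mem_def, List.getLast?_eq_getElem?, List.getElem?_eq_getElem (by omega)] at hbp'
    have := Option.some_inj.1 hbp'
    simpa [hl] using this
  have hstep : ∀ j (hj : j < l), ∃ S, LeadsTo K P[j] S ∧ IsLeast (S : Set ℕ) P[j + 1].1 :=
    fun j hj => List.isChain_iff_getElem.1 hchain j (by omega)
  -- Each entry leads somewhere according to some report, so its ID belongs to an agent of the
  -- component. Indices beyond the list get the dummy value `a`.
  have hex : ∀ j, ∃ c, ∀ hj : j < P.length, ids c = P[j].1 ∧ G.graph.Reachable (pos a) (pos c) := by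
    intro j
    by_cases hj : j < P.length
    · have : ∃ S, LeadsTo K P[j] S := by
        rcases Nat.lt_or_ge j l with h | h
        · obtain ⟨S, hS, -⟩ := hstep j h
          exact ⟨S, hS⟩
        · obtain rfl : j = l := by omega
          exact ⟨∅, hend ▸ hlast⟩
      obtain ⟨S, m, hmK, hid, -⟩ := this
      obtain ⟨c, hc, rfl⟩ := mem_reports.1 hmK
      exact ⟨c, fun _ => ⟨hid, hc⟩⟩
    · exact ⟨a, fun h => absurd h hj⟩
  choose b hb using hex
  have hreach : ∀ j ≤ l, G.graph.Reachable (pos a) (pos (b j)) := fun j hj => (hb j (by omega)).2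
  have hPj : ∀ j (hj : j ≤ l), P[j] = (ids (b j), P[j].2) := fun j hj =>
    Prod.ext (hb j (by omega)).1.symm rfl
  have hexit : ∀ c, G.graph.Reachable (pos a) (pos c) →
      exitPort σ ids G pos c = P.lookup (ids c) := by
    intro c hc
    have hKc := reports_congr (ids := ids) hc
    unfold exitPort
    rw [← hKc, if_pos hm, if_pos hK]
  have hexitb : ∀ j (hj : j ≤ l), exitPort σ ids G pos (b j) = some P[j].2 := by
    intro j hj
    rw [hexit _ (hreach j hj), lookup_eq_some_iff_mem hnd, ← hPj j hj]
    exact List.getElem_mem _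
  have hnext : ∀ j (hj : j ≤ l) S, LeadsTo K P[j] S →
      idsAt ids pos (nextPos σ ids G pos (b j)) = S := by
    intro j hj S hS
    rw [hPj j hj, leadsTo_reports hids (hreach j hj)] at hS
    obtain ⟨u, hu, hS⟩ := hS
    rw [nextPos_of_via (hexitb j hj) hu, hS]
  have hstep' : ∀ j < l, nextPos σ ids G pos (b j) = pos (b (j + 1)) ∧
      IsLeader ids pos (b (j + 1)) := by
    intro j hj
    obtain ⟨S, hS, hmin⟩ := hstep j hj
    have hS' := hnext j hj.le S hS
    rw [← (hb (j + 1) (by omega)).1, ← hS'] at hmin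
    obtain ⟨c, hc, hcb⟩ := mem_idsAt.1 (Finset.mem_coe.1 hmin.1)
    obtain rfl := hids hcb
    rw [← hc] at hmin
    exact ⟨hc.symm, isLeast_idsAt.1 hmin⟩
  rw [← hhead, ← (hb 0 hpos).1] at hleast
  have hmulti : 1 < (idsAt ids pos (pos (b 0))).card := by
    obtain ⟨m, hmK, hid, hcount⟩ := hleast.1
    obtain ⟨c, hc, rfl⟩ := mem_reports.1 hmK
    obtain rfl := hids hid
    exact hcount
  refine ⟨l, b, hreach, ?_, ?_, ?_, fun j hj => (hstep' j hj).1, ?_, ?_⟩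
  · intro j hj
    -- The first slider is a leader by minimality over all multinodes, the later ones by the chain
    -- condition.
    rcases j with _ | j
    · intro c hc
      refine hleast.2 ⟨_, mem_reports.2 ⟨c, hc ▸ hreach 0 hj, rfl⟩, rfl, ?_⟩
      change 1 < (idsAt ids pos (pos c)).card
      rwa [hc]
    · exact (hstep' j (by omega)).2
  · intro i hi j hj hij
    have : (P.map Prod.fst)[i]'(by simp; omega) = (P.map Prod.fst)[j]'(by simp; omega) := by
      rw [List.getElem_map, List.getElem_map, ← (hb i (by omega)).1, ← (hb j (by omega)).1, hij]
    exact (hnd.getElem_inj_iff).1 this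
  · obtain ⟨c, d, hc, hd, hcd⟩ := (one_lt_card_idsAt hids).1 hmulti
    by_cases h : c = b 0
    · exact ⟨d, fun h' => hcd (h.trans h'.symm), hd⟩
    · exact ⟨c, h, hc⟩
  · exact idsAt_eq_empty_iff.1 (hnext l le_rfl ∅ (hend ▸ hlast))
  · intro c hc hne
    refine nextPos_of_exitPort_eq_none ?_
    rw [hexit c hc, Option.eq_none_iff_forall_not_mem]
    intro p hp
    rw [Option.mem_def, lookup_eq_some_iff_mem hnd] at hp
    obtain ⟨j, hj, hjp⟩ := List.getElem_of_mem hp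
    refine hne j (by omega) (hids ?_)
    rw [(hb j hj).1, hjp]

/-- The hole `h` may be far from all agents, but a path to it leaves the occupied nodes somewhere,
and the agent there sees a hole. -/
theorem holeKnown_of_reachable (hids : Function.Injective ids) {a : A} {h : V}
    (hm : MultinodeKnown (reports ids G pos a)) (hreach : G.graph.Reachable (pos a) h)
    (hh : ∀ c, pos c ≠ h) : HoleKnown (reports ids G pos a) := by
  obtain ⟨P, hP⟩ := exists_isSlidingPath hids hm hreach hh
  obtain ⟨bp, -, m, hmK, -, hbp⟩ := hP.hole
  exact ⟨m, hmK, bp.2, hbp⟩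

theorem nextPos_of_not_holeKnown {a : A} (hm : MultinodeKnown (reports ids G pos a))
    (hK : ¬HoleKnown (reports ids G pos a)) : nextPos σ ids G pos a = pos a := by
  refine nextPos_of_exitPort_eq_none ?_
  rw [exitPort, if_pos hm, if_neg hK]

/-- In a component without multinode, the agent with the minimum ID among those next to a hole moves
to a hole. -/
theorem nextPos_of_isLeast (hids : Function.Injective ids) {a : A}
    (hm : ¬MultinodeKnown (reports ids G pos a))
    (ha : IsLeast {i | ∃ m ∈ reports ids G pos a, m.id = i ∧ ∃ p, m.view.HoleAt p} (ids a)) (c : A) :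
    pos c ≠ nextPos σ ids G pos a := by
  have hne : {p | (viewAt ids G pos (pos a)).HoleAt p}.Nonempty := by
    obtain ⟨m, hmK, hid, p, hp⟩ := ha.1
    obtain ⟨b, -, rfl⟩ := mem_reports.1 hmK
    obtain rfl := hids hid
    exact ⟨p, hp⟩
  obtain ⟨u, hu, hh⟩ := viewAt_holeAt.1 (Nat.sInf_mem hne)
  rw [nextPos_of_via (by rw [exitPort, if_neg hm, if_pos ha]) hu]
  exact hh c

theorem nextPos_of_not_isLeast {a : A} (hm : ¬MultinodeKnown (reports ids G pos a))
    (ha : ¬IsLeast {i | ∃ m ∈ reports ids G pos a, m.id = i ∧ ∃ p, m.view.HoleAt p} (ids a)) :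
    nextPos σ ids G pos a = pos a := by
  refine nextPos_of_exitPort_eq_none ?_
  rw [exitPort, if_neg hm, if_neg ha]

theorem eq_of_isLeast (hids : Function.Injective ids) {a c : A}
    (hac : G.graph.Reachable (pos a) (pos c))
    (ha : IsLeast {i | ∃ m ∈ reports ids G pos a, m.id = i ∧ ∃ p, m.view.HoleAt p} (ids a))
    (hc : IsLeast {i | ∃ m ∈ reports ids G pos c, m.id = i ∧ ∃ p, m.view.HoleAt p} (ids c)) :
    a = c := by
  rw [← reports_congr hac] at hc
  exact hids (ha.unique hc)

/-- In each component at most one agent moves to a hole. -/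
theorem nextPos_hole_unique (hσ : IsSlidingRule σ) (hids : Function.Injective ids) {a c : A}
    (hac : G.graph.Reachable (pos a) (pos c)) (ha : ∀ b, pos b ≠ nextPos σ ids G pos a)
    (hc : ∀ b, pos b ≠ nextPos σ ids G pos c) : a = c := by
  by_cases hm : MultinodeKnown (reports ids G pos a)
  · by_cases hK : HoleKnown (reports ids G pos a)
    · obtain ⟨l, b, hs⟩ := exists_slides hσ hids hm hK
      rw [hs.eq_last .rfl ha, hs.eq_last hac hc]
    · exact absurd (nextPos_of_not_holeKnown hm hK).symm (ha a)
  · have hm' : ¬MultinodeKnown (reports ids G pos c) := by rwa [← reports_congr hac]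
    refine eq_of_isLeast hids hac ?_ ?_
    · by_contra h
      exact ha a (nextPos_of_not_isLeast hm h).symm
    · by_contra h
      exact hc c (nextPos_of_not_isLeast hm' h).symm

/-- Moves stay within components, so colliding leaders share one. There, either a slide takes place,
or all stay, or at most one agent moves, and it moves to a hole. -/
theorem nextPos_injOn (hσ : IsSlidingRule σ) (hids : Function.Injective ids) :
    Set.InjOn (nextPos σ ids G pos) {a | IsLeader ids pos a} := by
  intro a hla c hlc h
  have hac : G.graph.Reachable (pos a) (pos c) :=
    (reachable_nextPos (σ := σ) (ids := ids) a).trans (h ▸ (reachable_nextPos c).symm)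
  by_cases hm : MultinodeKnown (reports ids G pos a)
  · by_cases hK : HoleKnown (reports ids G pos a)
    · obtain ⟨l, b, hs⟩ := exists_slides hσ hids hm hK
      exact hs.injOn hids .rfl hac hla hlc h
    · rw [nextPos_of_not_holeKnown hm hK] at h
      rw [reports_congr hac] at hm hK
      rw [nextPos_of_not_holeKnown hm hK] at h
      exact hla.eq hids hlc h
  · have hm' : ¬MultinodeKnown (reports ids G pos c) := by rwa [← reports_congr hac]
    by_cases ha : IsLeast {i | ∃ m ∈ reports ids G pos a, m.id = i ∧ ∃ p, m.view.HoleAt p} (ids a)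
    · have := nextPos_of_isLeast (σ := σ) hids hm ha
      exact nextPos_hole_unique hσ hids hac this (h ▸ this)
    · have ha' := nextPos_of_not_isLeast (σ := σ) hm ha
      by_cases hc : IsLeast {i | ∃ m ∈ reports ids G pos c, m.id = i ∧ ∃ p, m.view.HoleAt p} (ids c)
      · exact absurd (ha'.symm.trans h) (nextPos_of_isLeast hids hm' hc a)
      · exact hla.eq hids hlc (ha'.symm.trans (h.trans (nextPos_of_not_isLeast hm' hc)))

/-! ### The number of occupied nodes as potential -/

open Classical in
/-- The nodes that are not holes. -/
noncomputable def occupied (pos : A → V) : Finset V := Finset.univ.image pos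

theorem mem_occupied {v : V} : v ∈ occupied pos ↔ ∃ a, pos a = v := by
  simp [occupied]

theorem card_occupied_le (pos : A → V) : (occupied pos).card ≤ Fintype.card A := by
  classical
  exact Finset.card_image_le

theorem card_le_card_occupied {next : A → V} {s : Finset A} (h : Set.InjOn next s) :
    s.card ≤ (occupied next).card := by
  classical
  have h' : (s.image next).card = s.card := Finset.card_image_of_injOn h
  rw [← h']
  refine Finset.card_le_card fun v hv => ?_
  obtain ⟨a, -, ha⟩ := Finset.mem_image.1 hv
  exact mem_occupied.2 ⟨a, ha⟩

open Classical in
theorem card_occupied_eq (hids : Function.Injective ids) (pos : A → V) :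
    (occupied pos).card = (Finset.univ.filter (IsLeader ids pos)).card := by
  rw [← Finset.card_image_of_injOn (s := Finset.univ.filter (IsLeader ids pos)) (f := pos)]
  · congr 1
    ext v
    simp only [mem_occupied, Finset.mem_image, Finset.mem_filter, Finset.mem_univ, true_and]
    constructor
    · rintro ⟨a, rfl⟩
      obtain ⟨b, hb, hlb⟩ := exists_isLeader ids pos a
      exact ⟨b, hlb, hb⟩
    · rintro ⟨a, -, rfl⟩
      exact ⟨a, rfl⟩
  · intro a ha b hb h
    simp only [Finset.coe_filter, Finset.mem_univ, true_and, Set.mem_ofPred_eq] at ha hb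
    exact ha.eq hids hb h

theorem card_occupied_le_nextPos (hσ : IsSlidingRule σ) (hids : Function.Injective ids) :
    (occupied pos).card ≤ (occupied (nextPos σ ids G pos)).card := by
  classical
  rw [card_occupied_eq hids]
  refine card_le_card_occupied ?_
  simpa using nextPos_injOn hσ hids

/-- The non-leader `x` from `Slides.exists_extra` can be added to the leaders without losing
injectivity of the round. -/
theorem card_occupied_lt_nextPos (hσ : IsSlidingRule σ) (hids : Function.Injective ids) {a : A}
    (hm : MultinodeKnown (reports ids G pos a)) (hK : HoleKnown (reports ids G pos a)) :
    (occupied pos).card < (occupied (nextPos σ ids G pos)).card := by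
  classical
  obtain ⟨l, b, hs⟩ := exists_slides hσ hids hm hK
  obtain ⟨x, hx, hlx, hne⟩ := hs.exists_extra hids
  have hmem : x ∉ Finset.univ.filter (IsLeader ids pos) := by simpa using hlx
  rw [card_occupied_eq hids, ← Nat.succ_le_iff, Nat.succ_eq_add_one,
    ← Finset.card_insert_of_notMem hmem]
  refine card_le_card_occupied ?_
  rw [Finset.coe_insert, Set.injOn_insert (by simpa using hlx)]
  refine ⟨by simpa using nextPos_injOn hσ hids, ?_⟩
  rintro ⟨c, hc, hcx⟩
  simp only [Finset.coe_filter, Finset.mem_univ, true_and, Set.mem_ofPred_eq] at hc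
  refine hne c ?_ hc hcx
  exact (hx.trans (hcx ▸ (reachable_nextPos c).symm))

/-- A multinode without a hole in its component persists; with a hole, the number of occupied nodes
grows. -/
theorem nextPos_eq_of_multinode (hσ : IsSlidingRule σ) (hids : Function.Injective ids) {a c : A}
    (hac : a ≠ c) (h : pos a = pos c)
    (hle : (occupied (nextPos σ ids G pos)).card ≤ (occupied pos).card) :
    nextPos σ ids G pos a = pos a ∧ nextPos σ ids G pos c = pos c := by
  have hm : MultinodeKnown (reports ids G pos a) :=
    (multinodeKnown_reports hids).2 ⟨a, c, .rfl, h, hac⟩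
  have hK : ¬HoleKnown (reports ids G pos a) := fun hK =>
    hle.not_gt (card_occupied_lt_nextPos hσ hids hm hK)
  refine ⟨nextPos_of_not_holeKnown hm hK, ?_⟩
  have hr : G.graph.Reachable (pos a) (pos c) := h ▸ .rfl
  rw [reports_congr hr] at hm hK
  exact nextPos_of_not_holeKnown hm hK

/-- Without multinodes, the only hole is visited as soon as it has a neighbour. -/
theorem exists_nextPos_eq_of_injective [Fintype V] (hcard : Fintype.card V = Fintype.card A + 1)
    (hids : Function.Injective ids) (hpos : Function.Injective pos) {v u : V}
    (hv : ∀ a, pos a ≠ v) (hu : G.graph.Adj v u) : ∃ a, nextPos σ ids G pos a = v := by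
  classical
  -- A second hole `w`, together with `v` and the distinct positions of the agents, would exceed the
  -- number of nodes.
  have hocc : ∀ w, w ≠ v → ∃ a, pos a = w := by
    intro w hw
    by_contra hno
    push Not at hno
    have hsub : insert w (insert v (occupied pos)) ⊆ Finset.univ := Finset.subset_univ _
    have h := Finset.card_le_card hsub
    rw [Finset.card_insert_of_notMem, Finset.card_insert_of_notMem, occupied,
      Finset.card_image_of_injective _ hpos, Finset.card_univ, Finset.card_univ] at h
    · omega
    · rw [mem_occupied]
      push Not
      exact hv
    · rw [Finset.mem_insert, mem_occupied]
      push Not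
      exact ⟨hw, hno⟩
  obtain ⟨b, rfl⟩ := hocc u hu.ne'
  set I : Set ℕ := {i | ∃ m ∈ reports ids G pos b, m.id = i ∧ ∃ p, m.view.HoleAt p} with hI
  have hne : I.Nonempty :=
    ⟨ids b, _, mem_reports.2 ⟨b, .rfl, rfl⟩, rfl, _,
      viewAt_holeAt.2 ⟨v, G.via_eq_some_iff.2 ⟨hu.symm, rfl⟩, hv⟩⟩
  have hleast : IsLeast I (sInf I) := ⟨Nat.sInf_mem hne, fun i hi => Nat.sInf_le hi⟩
  obtain ⟨m, hmK, hid, -⟩ := hleast.1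
  obtain ⟨a, ha, rfl⟩ := mem_reports.1 hmK
  have hm : ¬MultinodeKnown (reports ids G pos a) := by
    rw [multinodeKnown_reports hids]
    rintro ⟨x, y, -, hxy, hne⟩
    exact hne (hpos hxy)
  have hid' : ids a = sInf I := hid
  rw [← hid', hI, reports_congr ha] at hleast
  refine ⟨a, ?_⟩
  by_contra h
  obtain ⟨c, hc⟩ := hocc _ h
  exact nextPos_of_isLeast hids hm hleast c hc

/-! ### Upper bound on the exploration time -/

section Upper

variable {D : DynamicGraph V} {T : ℕ} {pos₀ : A → V}

theorem card_occupied_run_mono (hσ : IsSlidingRule σ) (hids : Function.Injective ids)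
    (D : DynamicGraph V) (pos₀ : A → V) :
    Monotone fun t => (occupied (run (perpetualExploration σ) ids D pos₀ t).pos).card := by
  refine monotone_nat_of_le_succ fun t => ?_
  rw [run_pos_succ]
  exact card_occupied_le_nextPos hσ hids

/-- In a window of `T` rounds a node is visited or the number of occupied nodes grows. -/
theorem card_occupied_run_lt [Fintype V] (hσ : IsSlidingRule σ) (hids : Function.Injective ids)
    (hcard : Fintype.card V = Fintype.card A + 1) (hV : 2 ≤ Fintype.card V)
    (hD : TPathConnected D T) (v : V) (s : ℕ)
    (hv : ∀ t, s ≤ t → t ≤ s + T → ∀ a, (run (perpetualExploration σ) ids D pos₀ t).pos a ≠ v) :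
    (occupied (run (perpetualExploration σ) ids D pos₀ s).pos).card <
      (occupied (run (perpetualExploration σ) ids D pos₀ (s + T)).pos).card := by
  classical
  set x := fun t => (run (perpetualExploration σ) ids D pos₀ t).pos with hx
  have hsucc : ∀ t, x (t + 1) = nextPos σ ids (D t) (x t) := run_pos_succ D pos₀
  have hmono : Monotone fun t => (occupied (x t)).card := card_occupied_run_mono hσ hids D pos₀
  change ∀ t, s ≤ t → t ≤ s + T → ∀ a, x t a ≠ v at hv
  change (occupied (x s)).card < (occupied (x (s + T))).card
  by_contra hlt
  have hconst : ∀ t, s ≤ t → t ≤ s + T → (occupied (x t)).card = (occupied (x s)).card :=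
    fun t h1 h2 => le_antisymm ((hmono h2).trans (not_lt.1 hlt)) (hmono h1)
  by_cases hinj : Function.Injective (x s)
  · obtain ⟨w, hw⟩ : ∃ w, w ≠ v := by
      have : Nontrivial V := Fintype.one_lt_card_iff_nontrivial.1 hV
      exact exists_ne v
    obtain ⟨i, hi, hiT, hreach⟩ := hD s v w
    obtain ⟨q⟩ := hreach
    -- All agents occupy distinct nodes at time `s`; the constant potential preserves this.
    have hinj' : Function.Injective (x i) := by
      have h1 := hconst i hi hiT.le
      rw [occupied, occupied, Finset.card_image_of_injective _ hinj] at h1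
      have := Finset.card_image_iff.1 h1
      simpa using this
    -- A walk from `v` to a different node has a first edge, so `v` has a neighbour in round `i`.
    cases q with
    | nil => exact hw rfl
    | cons hadj _ =>
      obtain ⟨a, ha⟩ := exists_nextPos_eq_of_injective (σ := σ) hcard hids hinj'
        (hv i hi hiT.le) hadj
      rw [← hsucc] at ha
      exact hv (i + 1) (by omega) (by omega) a ha
  · obtain ⟨a, c, hac, hne⟩ : ∃ a c, x s a = x s c ∧ a ≠ c := by
      simpa [Function.Injective] using hinj
    have hstay : ∀ t ≤ T, x (s + t) a = x s a ∧ x (s + t) c = x s a := by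
      intro t
      induction t with
      | zero => exact fun _ => ⟨rfl, hac.symm⟩
      | succ t ih =>
        intro ht
        have ih := ih (by omega)
        have hle : (occupied (nextPos σ ids (D (s + t)) (x (s + t)))).card ≤
            (occupied (x (s + t))).card := by
          rw [← hsucc, add_assoc, hconst (s + (t + 1)) (by omega) (by omega),
            hconst (s + t) (by omega) (by omega)]
        have := nextPos_eq_of_multinode hσ hids hne (ih.1.trans ih.2.symm) hle
        rw [← add_assoc, hsucc, this.1, this.2]
        exact ih
    obtain ⟨i, hi, hiT, hreach⟩ := hD s (x s a) v
    obtain ⟨t, rfl⟩ := Nat.exists_eq_add_of_le hi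
    obtain ⟨ha, hc⟩ := hstay t (by omega)
    rw [← ha] at hreach
    have hm : MultinodeKnown (reports ids (D (s + t)) (x (s + t)) a) :=
      (multinodeKnown_reports hids).2 ⟨a, c, .rfl, ha.trans hc.symm, hne⟩
    have hK := holeKnown_of_reachable hids hm hreach (hv _ hi hiT.le)
    have h := card_occupied_lt_nextPos hσ hids hm hK
    rw [← hsucc, hconst (s + t + 1) (by omega) (by omega), hconst _ hi hiT.le] at h
    exact h.false

theorem exists_visit [Fintype V] (hσ : IsSlidingRule σ) (hids : Function.Injective ids)
    (hcard : Fintype.card V = Fintype.card A + 1) (hV : 2 ≤ Fintype.card V)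
    (hD : TPathConnected D T) (v : V) (s : ℕ) :
    ∃ t, s ≤ t ∧ t ≤ s + Fintype.card A * T ∧
      ∃ a, (run (perpetualExploration σ) ids D pos₀ t).pos a = v := by
  by_contra hno
  push Not at hno
  have key : ∀ j ≤ Fintype.card A,
      (occupied (run (perpetualExploration σ) ids D pos₀ s).pos).card + j ≤
        (occupied (run (perpetualExploration σ) ids D pos₀ (s + j * T)).pos).card := by
    intro j
    induction j with
    | zero => simp
    | succ j ih =>
      intro hj
      have hjT : (j + 1) * T ≤ Fintype.card A * T := Nat.mul_le_mul_right T hj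
      rw [Nat.succ_mul] at hjT
      have h := card_occupied_run_lt (pos₀ := pos₀) hσ hids hcard hV hD v (s + j * T)
        fun t h1 h2 => hno t (by omega) (by omega)
      have := ih (by omega)
      rw [Nat.succ_mul, ← add_assoc s]
      omega
  have h1 := key _ le_rfl
  have h2 := card_occupied_le (run (perpetualExploration σ) ids D pos₀ (s + Fintype.card A * T)).pos
  obtain ⟨a⟩ : Nonempty A := Fintype.card_pos_iff.1 (by omega)
  -- Starting from at least one occupied node, `Fintype.card A` increases exceed the maximum.
  have h3 : 0 < (occupied (run (perpetualExploration σ) ids D pos₀ s).pos).card :=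
    Finset.card_pos.2 ⟨_, mem_occupied.2 ⟨a, rfl⟩⟩
  omega

end Upper

/-! ### Lower bound on a pulsing graph -/

section Lower

theorem exists_portGraph [Finite V] (H : SimpleGraph V) : ∃ G : PortGraph V, G.graph = H := by
  have h : ∀ v, ∃ f : V → ℕ, Set.BijOn f (H.neighborSet v) (Set.Iio (H.neighborSet v).ncard) := by
    intro v
    refine Set.Finite.exists_bijOn_of_encard_eq (Set.toFinite _) ?_
    rw [← (Set.toFinite (H.neighborSet v)).cast_ncard_eq, ← (Set.finite_Iio _).cast_ncard_eq]
    simp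
  choose f hf using h
  exact ⟨⟨H, f, hf⟩, rfl⟩

/-- The dynamic graph that is complete once every `T` rounds and has no edges otherwise. -/
noncomputable def pulse (V : Type*) [Finite V] (T : ℕ) : DynamicGraph V := fun r =>
  (exists_portGraph (if T ∣ r + 1 then (⊤ : SimpleGraph V) else ⊥)).choose

theorem pulse_graph [Finite V] {T r : ℕ} :
    (pulse V T r).graph = if T ∣ r + 1 then ⊤ else ⊥ :=
  (exists_portGraph (if T ∣ r + 1 then (⊤ : SimpleGraph V) else ⊥)).choose_spec

theorem pulse_tPathConnected [Finite V] {T : ℕ} (hT : 1 ≤ T) : TPathConnected (pulse V T) T := by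
  intro r u v
  have hmod := Nat.mod_lt r hT
  have hdiv := Nat.div_add_mod r T
  -- The last round of the length-`T` block containing `r` is a pulse within the window.
  refine ⟨T * (r / T) + (T - 1), by omega, by omega, ?_⟩
  rw [pulse_graph, if_pos ⟨r / T + 1, by rw [mul_add]; omega⟩]
  exact SimpleGraph.connected_top_iff.2 ⟨u⟩ |>.preconnected u v

theorem nextPos_of_graph_eq_bot (h : G.graph = ⊥) : nextPos σ ids G pos = pos := by
  funext a
  have := reachable_nextPos (G := G) (pos := pos) (σ := σ) (ids := ids) a
  rw [h, SimpleGraph.reachable_bot] at this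
  exact this.symm

/-- If all agents start on one node, then on the pulsing graph every pulse reveals at most one new
node. -/
theorem exists_visited_finset [Finite V] (hσ : IsSlidingRule σ) (hids : Function.Injective ids)
    {T : ℕ} (v₀ : V) (t : ℕ) : ∃ W : Finset V, W.card ≤ 1 + t / T ∧
      ∀ s ≤ t, ∀ a, (run (perpetualExploration σ) ids (pulse V T) (fun _ => v₀) s).pos a ∈ W := by
  classical
  induction t with
  | zero =>
    refine ⟨{v₀}, by simp, fun s hs a => ?_⟩
    obtain rfl : s = 0 := by omega
    simp [run]
  | succ t ih =>
    obtain ⟨W, hW, hmem⟩ := ih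
    set x := fun t => (run (perpetualExploration σ) ids (pulse V T) (fun _ => v₀) t).pos with hx
    change ∀ s ≤ t, ∀ a, x s a ∈ W at hmem
    change ∃ W : Finset V, W.card ≤ 1 + (t + 1) / T ∧ ∀ s ≤ t + 1, ∀ a, x s a ∈ W
    have hsucc : x (t + 1) = nextPos σ ids (pulse V T t) (x t) := run_pos_succ _ _ t
    -- The quotient grows exactly at pulses, matching the one node that a pulse may add to `W`.
    rw [Nat.succ_div]
    by_cases hdvd : T ∣ t + 1
    · rw [if_pos hdvd]
      by_cases hnew : ∃ a, ∀ b, x t b ≠ x (t + 1) a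
      · obtain ⟨a, ha⟩ := hnew
        refine ⟨insert (x (t + 1) a) W, (Finset.card_insert_le _ _).trans (by omega), ?_⟩
        intro s hs c
        rcases hs.lt_or_eq with hs | rfl
        · exact Finset.mem_insert_of_mem (hmem s (by omega) c)
        · by_cases hc : ∀ b, x t b ≠ x (t + 1) c
          · have hr : (pulse V T t).graph.Reachable (x t a) (x t c) := by
              rw [pulse_graph, if_pos hdvd]
              exact SimpleGraph.connected_top_iff.2 ⟨v₀⟩ |>.preconnected _ _
            rw [hsucc] at ha hc
            rw [nextPos_hole_unique hσ hids hr ha hc]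
            exact Finset.mem_insert_self _ _
          · push Not at hc
            obtain ⟨b, hb⟩ := hc
            rw [← hb]
            exact Finset.mem_insert_of_mem (hmem t le_rfl b)
      · push Not at hnew
        refine ⟨W, by omega, fun s hs c => ?_⟩
        rcases hs.lt_or_eq with hs | rfl
        · exact hmem s (by omega) c
        · obtain ⟨b, hb⟩ := hnew c
          rw [← hb]
          exact hmem t le_rfl b
    · rw [if_neg hdvd]
      refine ⟨W, by omega, fun s hs c => ?_⟩
      rcases hs.lt_or_eq with hs | rfl
      · exact hmem s (by omega) c
      · rw [hsucc, nextPos_of_graph_eq_bot (by rw [pulse_graph, if_neg hdvd])]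
        exact hmem t le_rfl c

end Lower

end Agents

/-- The length is at most `Nat.log 2 n + 1`; as `n ≥ 2`, the extra bit is absorbed by the factor 2.
-/
theorem length_bits_le_logb {n i : ℕ} (hn : 2 ≤ n) (hi : i ≤ n - 1) :
    (i.bits.length : ℝ) ≤ 2 * Real.logb 2 n := by
  have hlt : i < 2 ^ (Nat.log 2 n + 1) :=
    lt_of_lt_of_le (by omega) (Nat.lt_pow_succ_log_self one_lt_two n).le
  have h1 : i.bits.length ≤ Nat.log 2 n + 1 := by
    rw [Nat.size_eq_bits_len]
    exact Nat.size_le.2 hlt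
  have h2 : 1 ≤ Nat.log 2 n := Nat.log_pos one_lt_two hn
  have h3 : (Nat.log 2 n : ℝ) ≤ Real.logb 2 n := by
    simpa using Real.natLog_le_logb n 2
  have h4 : (i.bits.length : ℝ) ≤ 2 * Nat.log 2 n := by
    exact_mod_cast (by omega : i.bits.length ≤ 2 * Nat.log 2 n)
  linarith

end DynExplore

theorem mainTheorem2 :
    ∃ c C B : ℝ, 0 < c ∧ 0 < C ∧ 0 < B ∧
      ∀ σ : Multiset Report → List (ℕ × ℕ), IsSlidingRule σ →
      ∀ n T : ℕ, 2 ≤ n → 1 ≤ T →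
      ∀ ids : Fin (n - 1) → ℕ, Function.Injective ids →
      (∀ a, ids a ∈ Finset.Icc 1 (n - 1)) →
        (∀ D : DynamicGraph (Fin n), TPathConnected D T → ∀ pos₀ : Fin (n - 1) → Fin n,
          PerpetuallyExplored (run (perpetualExploration σ) ids D pos₀) ∧
          (∀ s : ℕ, ∃ t : ℕ, (t : ℝ) ≤ C * (n * T) ∧
            ExploredBetween (run (perpetualExploration σ) ids D pos₀) s (s + t)) ∧
          (∀ (t : ℕ) (a : Fin (n - 1)),
            (((run (perpetualExploration σ) ids D pos₀ t).mem a).length : ℝ)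
              ≤ B * Real.logb 2 n)) ∧
        (∃ D : DynamicGraph (Fin n), TPathConnected D T ∧ ∃ pos₀ : Fin (n - 1) → Fin n,
          ∀ t : ℕ, ExploredBetween (run (perpetualExploration σ) ids D pos₀) 0 t →
            c * (n * T) ≤ t) := by
  refine ⟨1 / 2, 1, 2, by norm_num, one_pos, two_pos, ?_⟩
  intro σ hσ n T hn hT ids hids hrange
  refine ⟨fun D hD pos₀ => ?_, pulse (Fin n) T, pulse_tPathConnected hT, ?_⟩
  · have hvisit := fun v s => exists_visit (pos₀ := pos₀) hσ hids
      (by simp only [Fintype.card_fin]; omega) (by simpa using hn) hD v s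
    refine ⟨fun v s => ?_, fun s => ⟨(n - 1) * T, ?_, fun v => ?_⟩, fun t a => ?_⟩
    · obtain ⟨t, h1, -, h⟩ := hvisit v s
      exact ⟨t, h1, h⟩
    · rw [one_mul]
      exact_mod_cast Nat.mul_le_mul_right T (Nat.sub_le n 1)
    · simpa using hvisit v s
    · rw [run_mem]
      exact length_bits_le_logb hn (Finset.mem_Icc.1 (hrange a)).2
  · refine ⟨fun _ => ⟨0, by omega⟩, fun t ht => ?_⟩
    obtain ⟨W, hW, hmem⟩ := exists_visited_finset hσ hids (T := T) (⟨0, by omega⟩ : Fin n) t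
    have huniv : W = Finset.univ := by
      refine Finset.eq_univ_iff_forall.2 fun v => ?_
      obtain ⟨s, -, hs, a, rfl⟩ := ht v
      exact hmem s hs a
    rw [huniv, Finset.card_univ, Fintype.card_fin] at hW
    -- From `n ≤ 1 + t / T` and `n ≥ 2` follows `n ≤ 2 * (n - 1) ≤ 2 * (t / T)`, whence the constant
    -- `1 / 2`.
    have h1 : n * T ≤ 2 * t := by
      calc n * T ≤ 2 * (t / T) * T := Nat.mul_le_mul_right T (by omega)
        _ = 2 * (t / T * T) := mul_assoc _ _ _
        _ ≤ 2 * t := Nat.mul_le_mul_left 2 (Nat.div_mul_le_self t T)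
    have h2 : (n * T : ℝ) ≤ 2 * t := by exact_mod_cast h1
    linarith
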